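/- Graphs are finite multigraphs, possibly with loops. Let $k,\ell$ be integers with $k\ge 0$ and $k\le\ell\le 2k-1$. A graph is *$(k,\ell)$-sparse* if every subgraph with $n'$ vertices and $m'\ge 1$ edges satisfies $m'\le kn'-\ell$; it is *$(k,\ell)$-tight* if, in addition, it has exactly $kn-\ell$ edges, where $n$ is its number of vertices. An *$\ell\mathsf{T}k$ decomposition* of a graph $G$ is a family $T_1,\dots,T_\ell$ of edge-disjoint trees in $G$ (each with at least one vertex, not necessarily spanning, possibly a single vertex) that together contain every edge of $G$ and such that each vertex of $G$ is in exactly $k$ of them. The *tree-pieces* in a subgraph $G'$ of $G$ are the connected components of $T_1\cap G',\dots,T_\ell\cap G'$ (single vertices included, and counted separately for each $i$). The decomposition is *proper* if there are at least $\ell$ tree-pieces in every subgraph $G'$ of $G$ with at least two vertices. A graph is a *proper $\ell\mathsf{T}k$* if it has a proper $\ell\mathsf{T}k$ decomposition. **Corollary (Crapo, Haas).** Let $k\le\ell\le 2k-1$. A graph $G$ is $(k,\ell)$-tight if and only if it is a proper $\ell\mathsf{T}k$. (The case $(k,\ell)=(2,3)$ is Crapo's characterization of Laman graphs, that is, $(2,3)$-tight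 graphs, as the proper $3\mathsf{T}2$ graphs.) -/

import Mathlib

namespace TreeDecomp

/-- Two vertices are joined by a (possibly trivial) walk. -/
def Reachable {α β : Type*} (G : Graph α β) : α → α → Prop :=
  Relation.ReflTransGen G.Adj

/-- The connected components of a multigraph, as sets of vertices. -/
def components {α β : Type*} (G : Graph α β) : Set (Set α) :=
  {C | ∃ x ∈ G.vertexSet, C = {y | Reachable G x y}}

/-- A multigraph is connected if it has a vertex and any two vertices are joined by a walk. -/
def IsConnected {α β : Type*} (G : Graph α β) : Prop :=
  G.vertexSet.Nonempty ∧ ∀ x ∈ G.vertexSet, ∀ y ∈ G.vertexSet, Reachable G x y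

/-- A multigraph is acyclic if no edge lies on a cycle: the ends of an edge are never joined
by a walk that avoids this edge. In particular there are no loops (the trivial walk avoids the
loop) and no parallel edges. -/
def IsAcyclic {α β : Type*} (G : Graph α β) : Prop :=
  ∀ e x y, G.IsLink e x y → ¬ Reachable (G.deleteEdges {e}) x y

/-- A tree is a connected acyclic multigraph (with at least one vertex). -/
def IsTree {α β : Type*} (G : Graph α β) : Prop :=
  IsConnected G ∧ IsAcyclic G

/-- `G` is `(k, ℓ)`-sparse: every subgraph with `n'` vertices and `m' ≥ 1` edges
satisfies `m' ≤ k n' - ℓ`. -/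
def IsSparse {α β : Type*} (k l : ℕ) (G : Graph α β) : Prop :=
  ∀ H : Graph α β, H ≤ G → H.edgeSet.Nonempty →
    (H.edgeSet.ncard : ℤ) ≤ (k : ℤ) * (H.vertexSet.ncard : ℤ) - (l : ℤ)

/-- `G` is `(k, ℓ)`-tight: it is `(k, ℓ)`-sparse and has exactly `k n - ℓ` edges,
where `n` is its number of vertices. -/
def IsTight {α β : Type*} (k l : ℕ) (G : Graph α β) : Prop :=
  IsSparse k l G ∧
    (G.edgeSet.ncard : ℤ) = (k : ℤ) * (G.vertexSet.ncard : ℤ) - (l : ℤ)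

/-- An `ℓTk` decomposition of `G`: a family of `ℓ` edge-disjoint trees in `G` (not necessarily
spanning, possibly single vertices) that together contain every edge of `G`, such that each
vertex of `G` is in exactly `k` of them. -/
structure IsTreeDecomposition {α β : Type*} (k l : ℕ) (G : Graph α β)
    (T : Fin l → Graph α β) : Prop where
  le : ∀ i, T i ≤ G
  isTree : ∀ i, IsTree (T i)
  edge_disjoint : ∀ i j, i ≠ j → Disjoint (T i).edgeSet (T j).edgeSet
  edge_cover : ∀ e ∈ G.edgeSet, ∃ i, e ∈ (T i).edgeSet
  vertex_count : ∀ v ∈ G.vertexSet, {i | v ∈ (T i).vertexSet}.ncard = k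

/-- The number of tree-pieces in the subgraph `H`: the trees `T i` are restricted to `H`, and
the connected components of these restrictions (single vertices included) are counted, tree by
tree. -/
noncomputable def numTreePieces {α β : Type*} {l : ℕ} (T : Fin l → Graph α β)
    (H : Graph α β) : ℕ :=
  ∑ i, (components (T i ⊓ H)).ncard

/-- The family `T` is proper in `G`: there are at least `ℓ` tree-pieces in every subgraph of `G`
with at least two vertices. -/
def IsProper {α β : Type*} {l : ℕ} (G : Graph α β) (T : Fin l → Graph α β) : Prop :=
  ∀ H : Graph α β, H ≤ G → H.vertexSet.Nontrivial → l ≤ numTreePieces T H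

/-- `G` is a proper `ℓTk`: it has a proper `ℓTk` decomposition. -/
def IsProperLTk {α β : Type*} (k l : ℕ) (G : Graph α β) : Prop :=
  ∃ T : Fin l → Graph α β, IsTreeDecomposition k l G T ∧ IsProper G T

end TreeDecomp

/-!
A forest with `n` vertices, `m` edges and `c` components satisfies `m + c = n`. Restricting the
trees of an `ℓTk` decomposition to a subgraph with `n'` vertices and `m'` edges and adding up these
formulas shows that the number of tree-pieces in the subgraph is `k n' - m'`, so that it is at
least `ℓ` if and only if `m' ≤ k n' - ℓ`: properness is sparsity. For the existence of a
decomposition, `(k, ℓ)`-sparsity with `k ≤ ℓ` implies `(k, k)`-sparsity, and then by Nash-Williams'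
theorem the edges can be partitioned into `k` spanning forests, whose components are `k n - m = ℓ`
trees. The forests come from the Rado-Horn theorem applied to the incidence vectors of the edges
modulo 2: a set of edges is independent if and only if it is acyclic, and its rank is the number of
vertices minus the number of components.
-/

open Finset in
lemma sum_ncard_inter_eq_mul {ι X : Type*} [Fintype ι] {A : ι → Set X} {S : Set X} {k : ℕ}
    (hS : S.Finite) (h : ∀ x ∈ S, {i | x ∈ A i}.ncard = k) :
    ∑ i, (A i ∩ S).ncard = k * S.ncard := by
  classical
  lift S to Finset X using hS
  calc ∑ i, (A i ∩ S).ncard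
    _ = ∑ i, #{x ∈ S | x ∈ A i} := by
        refine sum_congr rfl fun i _ ↦ ?_
        rw [← Set.ncard_coe_finset, coe_filter, Set.inter_comm]
        rfl
    _ = ∑ x ∈ S, #{i | x ∈ A i} :=
        sum_card_bipartiteAbove_eq_sum_card_bipartiteBelow fun i x ↦ x ∈ A i
    _ = ∑ _x ∈ S, k := sum_congr rfl fun _ hx ↦ by
        rw [← h _ hx, ← Set.ncard_coe_finset, coe_filter_univ]
    _ = k * (S : Set X).ncard := by
        rw [sum_const, smul_eq_mul, mul_comm, Set.ncard_coe_finset]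

lemma sum_ncard_inter_eq_ncard {ι X : Type*} [Fintype ι] {A : ι → Set X} {S : Set X}
    (hS : S.Finite) (h_disj : ∀ i j, i ≠ j → Disjoint (A i) (A j))
    (h_cover : ∀ x ∈ S, ∃ i, x ∈ A i) : ∑ i, (A i ∩ S).ncard = S.ncard := by
  rw [sum_ncard_inter_eq_mul (k := 1) hS, one_mul]
  intro x hx
  obtain ⟨i, hi⟩ := h_cover x hx
  refine Set.ncard_eq_one.2 ⟨i, Set.eq_singleton_iff_unique_mem.2 ⟨hi, fun j hj ↦ ?_⟩⟩
  by_contra hji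
  exact Set.disjoint_left.1 (h_disj j i hji) hj hi

open Finset in
/-- The hypothesis of Rado's theorem for a family `A` of finite sets: the union of any subfamily
`J` has `f`-value at least `#J`. For `f = card` it is Hall's marriage condition. -/
def RadoCondition {ι X : Type*} [DecidableEq X] (f : Finset X → ℕ) (A : ι → Finset X) : Prop :=
  ∀ J : Finset ι, #J ≤ f (J.biUnion A)

namespace RadoCondition

open Finset Function

variable {ι X : Type*} [DecidableEq X] {f : Finset X → ℕ} {A : ι → Finset X}

lemma nonempty (hA : RadoCondition f A) (f_empty : f ∅ = 0) (i : ι) : (A i).Nonempty := by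
  by_contra! hi
  have := hA {i}
  simp [hi, f_empty] at this

lemma exists_le_card_of_not_update [DecidableEq ι] (hA : RadoCondition f A) {i : ι} {B : Finset X}
    (hB : ¬ RadoCondition f (update A i B)) :
    ∃ J : Finset ι, i ∉ J ∧ f (B ∪ J.biUnion A) ≤ #J := by
  simp only [RadoCondition, not_forall, not_le] at hB
  obtain ⟨J, hJ⟩ := hB
  have biUnion_update {J' : Finset ι} (hi : i ∉ J') :
      J'.biUnion (update A i B) = J'.biUnion A :=
    biUnion_congr rfl fun j hj ↦ update_of_ne (ne_of_mem_of_not_mem hj hi) _ _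
  by_cases hi : i ∈ J
  · refine ⟨J.erase i, notMem_erase i J, ?_⟩
    rw [← insert_erase hi, biUnion_insert, biUnion_update (notMem_erase i J),
      card_insert_of_notMem (notMem_erase i J), update_self] at hJ
    exact Nat.lt_succ_iff.1 hJ
  · rw [biUnion_update hi] at hJ
    exact absurd (hA J) hJ.not_ge

/-- If neither replacement worked, submodularity applied to the two violating subfamilies would
contradict the condition for `A`. -/
lemma update_or_update [DecidableEq ι] (hA : RadoCondition f A) (f_mono : Monotone f)
    (f_submod : ∀ S T, f (S ∪ T) + f (S ∩ T) ≤ f S + f T) {i : ι} {B C : Finset X}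
    (hBC : A i ⊆ B ∪ C) :
    RadoCondition f (update A i B) ∨ RadoCondition f (update A i C) := by
  by_contra! h
  obtain ⟨J, hiJ, hJ⟩ := hA.exists_le_card_of_not_update h.1
  obtain ⟨K, hiK, hK⟩ := hA.exists_le_card_of_not_update h.2
  have h_union : #(J ∪ K) + 1 ≤ f ((B ∪ J.biUnion A) ∪ (C ∪ K.biUnion A)) := by
    rw [← card_insert_of_notMem (by simp [hiJ, hiK] : i ∉ J ∪ K)]
    refine (hA _).trans (f_mono ?_)
    rw [biUnion_insert, union_biUnion, union_union_union_comm]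
    exact union_subset_union_left hBC
  have h_inter : #(J ∩ K) ≤ f ((B ∪ J.biUnion A) ∩ (C ∪ K.biUnion A)) :=
    (hA _).trans <| f_mono <| subset_inter
      ((biUnion_subset_biUnion_of_subset_left A inter_subset_left).trans subset_union_right)
      ((biUnion_subset_biUnion_of_subset_left A inter_subset_right).trans subset_union_right)
  have := f_submod (B ∪ J.biUnion A) (C ∪ K.biUnion A)
  have := card_union_add_card_inter J K
  lia

/-- **Rado's theorem**, proved by shrinking the members of the family one element at a time until
all of them are singletons. -/
theorem exists_transversal [Finite ι] (hA : RadoCondition f A) (f_empty : f ∅ = 0)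
    (f_mono : Monotone f) (f_submod : ∀ S T, f (S ∪ T) + f (S ∩ T) ≤ f S + f T) :
    ∃ φ : ι → X, (∀ i, φ i ∈ A i) ∧ RadoCondition f fun i ↦ {φ i} := by
  classical
  have := Fintype.ofFinite ι
  induction hn : ∑ i, #(A i) using Nat.strong_induction_on generalizing A with
  | _ n ih =>
  by_cases h_card : ∀ i, #(A i) ≤ 1
  · choose φ hφ using fun i ↦
      card_eq_one.1 ((h_card i).antisymm (card_pos.2 (hA.nonempty f_empty i)))
    obtain rfl : A = fun i ↦ {φ i} := funext hφ
    exact ⟨φ, fun i ↦ mem_singleton_self _, hA⟩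
  push Not at h_card
  obtain ⟨i, hi⟩ := h_card
  obtain ⟨x, hx, y, hy, hxy⟩ := one_lt_card.1 hi
  have transversal_of_erase {z : X} (hz : z ∈ A i)
      (h : RadoCondition f (update A i ((A i).erase z))) :
      ∃ φ : ι → X, (∀ i, φ i ∈ A i) ∧ RadoCondition f fun i ↦ {φ i} := by
    have h_le : update A i ((A i).erase z) ≤ A := update_le_self_iff.2 (erase_subset z (A i))
    have h_lt : ∑ j, #(update A i ((A i).erase z) j) < n := hn ▸
      sum_lt_sum (fun j _ ↦ card_le_card (h_le j))
        ⟨i, mem_univ i, by simpa using card_erase_lt_of_mem hz⟩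
    obtain ⟨φ, hφ, hφ'⟩ := ih _ h_lt h rfl
    exact ⟨φ, fun j ↦ h_le j (hφ j), hφ'⟩
  have h_erase : A i ⊆ (A i).erase x ∪ (A i).erase y := fun z hz ↦ by
    simp only [mem_union, mem_erase]
    grind
  exact (hA.update_or_update f_mono f_submod h_erase).elim
    (transversal_of_erase hx) (transversal_of_erase hy)

end RadoCondition

section LinearAlgebra

open Finset Submodule Module

variable {K M N ι X : Type*} [DivisionRing K] [AddCommGroup M] [Module K M]
  [AddCommGroup N] [Module K N]

lemma finrank_span_image_union_add_inter_le (v : X → M) {s t : Set X} (hs : s.Finite)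
    (ht : t.Finite) :
    finrank K (span K (v '' (s ∪ t))) + finrank K (span K (v '' (s ∩ t))) ≤
      finrank K (span K (v '' s)) + finrank K (span K (v '' t)) := by
  have := FiniteDimensional.span_of_finite K (hs.image v)
  have := FiniteDimensional.span_of_finite K (ht.image v)
  rw [← finrank_sup_add_finrank_inf_eq (span K (v '' s)), Set.image_union, span_union]
  gcongr
  exact finrank_mono (le_inf (span_mono (by gcongr; exact Set.inter_subset_left))
    (span_mono (by gcongr; exact Set.inter_subset_right)))

lemma finrank_span_image_eq_ncard {v : X → M} {s : Set X} (h : LinearIndepOn K v s) :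
    finrank K (span K (v '' s)) = s.ncard := by
  rw [← h.injOn.ncard_image, finrank, rank_span_set h.id_image]
  rfl

lemma finrank_map_add_finrank_inf_ker (f : M →ₗ[K] N) (W : Submodule K M)
    [FiniteDimensional K W] :
    finrank K (W.map f) + finrank K (W ⊓ LinearMap.ker f : Submodule K M) = finrank K W := by
  rw [← LinearMap.finrank_range_add_finrank_ker (f.domRestrict W), LinearMap.range_domRestrict,
    LinearMap.ker_domRestrict, ← map_comap_subtype, finrank_map_subtype_eq]

lemma finrank_supported (s : Set X) : finrank K (Finsupp.supported K K s) = s.ncard := by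
  rw [Finsupp.supported_eq_span_single]
  exact finrank_span_image_eq_ncard ((Finsupp.linearIndependent_single_one K X).linearIndepOn s)

theorem exists_linearIndependent_transversal [Finite ι] [DecidableEq X] {v : X → M}
    {A : ι → Finset X}
    (hA : RadoCondition (fun S : Finset X ↦ finrank K (span K (v '' S))) A) :
    ∃ φ : ι → X, (∀ i, φ i ∈ A i) ∧ LinearIndependent K fun i ↦ v (φ i) := by
  have := Fintype.ofFinite ι
  have f_empty : finrank K (span K (v '' (∅ : Finset X))) = 0 := by
    rw [coe_empty, Set.image_empty, span_empty, finrank_bot]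
  have f_mono : Monotone fun S : Finset X ↦ finrank K (span K (v '' S)) := fun S T hST ↦
    have := FiniteDimensional.span_of_finite K (T.finite_toSet.image v)
    finrank_mono (span_mono (Set.image_mono hST))
  have f_submod (S T : Finset X) :
      finrank K (span K (v '' (S ∪ T : Finset X))) + finrank K (span K (v '' (S ∩ T : Finset X))) ≤
        finrank K (span K (v '' S)) + finrank K (span K (v '' T)) := by
    rw [coe_union, coe_inter]
    exact finrank_span_image_union_add_inter_le v S.finite_toSet T.finite_toSet
  obtain ⟨φ, hφA, hφ⟩ := hA.exists_transversal f_empty f_mono f_submod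
  refine ⟨φ, hφA, linearIndependent_iff_card_le_finrank_span.2 ?_⟩
  have h_range : v '' (univ.biUnion fun i ↦ {φ i} : Finset X) = Set.range fun i ↦ v (φ i) := by
    rw [biUnion_singleton, coe_image, coe_univ, Set.image_univ, ← Set.range_comp']
  rw [Set.finrank, ← h_range]
  exact hφ univ

lemma mul_finrank_span_image_le_finrank_span_single (k : ℕ) (v : ι → M) (J : Finset ι) :
    k * finrank K (span K (v '' J)) ≤
      finrank K (span K ((fun p : ι × Fin k ↦ (Pi.single p.2 (v p.1) : Fin k → M)) ''
        (J ×ˢ univ : Finset (ι × Fin k)))) := by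
  set U := span K (v '' J)
  set W := span K ((fun p : ι × Fin k ↦ (Pi.single p.2 (v p.1) : Fin k → M)) ''
    (J ×ˢ univ : Finset (ι × Fin k)))
  have := FiniteDimensional.span_of_finite K (J.finite_toSet.image v)
  have : FiniteDimensional K W := FiniteDimensional.span_of_finite K (Set.toFinite _)
  have single_mem (j : Fin k) : U ≤ W.comap (LinearMap.single K (fun _ ↦ M) j) := by
    rw [span_le]
    rintro _ ⟨i, hi, rfl⟩
    exact subset_span ⟨(i, j), by simpa using hi, rfl⟩
  have mem_W (u : Fin k → U) : U.subtype.compLeft (Fin k) u ∈ W := by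
    rw [← LinearMap.sum_single_apply _ (U.subtype.compLeft (Fin k) u)]
    exact sum_mem fun j _ ↦ single_mem j (u j).2
  have inj : Function.Injective ((U.subtype.compLeft (Fin k)).codRestrict W mem_W) :=
    (LinearMap.injective_codRestrict_iff ..).2 U.injective_subtype.comp_left
  calc k * finrank K U = finrank K (Fin k → U) := by simp [finrank_pi_fintype]
    _ ≤ finrank K W := LinearMap.finrank_le_finrank_of_injective inj

/-- The **Rado-Horn theorem**: apply Rado's theorem to the `k` copies of each vector in the
`k`-fold direct sum; choosing a copy of `v i` is choosing a colour for `i`. -/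
theorem exists_coloring_linearIndepOn [Finite ι] {k : ℕ} {v : ι → M}
    (h : ∀ J : Finset ι, #J ≤ k * finrank K (span K (v '' J))) :
    ∃ c : ι → Fin k, ∀ j, LinearIndepOn K v (c ⁻¹' {j}) := by
  classical
  let copy (p : ι × Fin k) : Fin k → M := Pi.single p.2 (v p.1)
  have hA : RadoCondition (fun S : Finset (ι × Fin k) ↦ finrank K (span K (copy '' S)))
      fun i ↦ {i} ×ˢ univ := fun J ↦ by
    have : J.biUnion (fun i ↦ {i} ×ˢ (univ : Finset (Fin k))) = J ×ˢ univ := by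
      ext ⟨i, j⟩
      simp
    rw [this]
    exact (h J).trans (mul_finrank_span_image_le_finrank_span_single k v J)
  obtain ⟨φ, hφA, hφ⟩ := exists_linearIndependent_transversal hA
  have fst_φ (i : ι) : (φ i).1 = i := by simpa using (mem_product.1 (hφA i)).1
  refine ⟨fun i ↦ (φ i).2, fun j ↦ .of_comp (LinearMap.single K (fun _ ↦ M) j) ?_⟩
  refine (hφ.linearIndepOn _).congr fun i hi ↦ ?_
  obtain rfl : (φ i).2 = j := hi
  simp [copy, fst_φ]

end LinearAlgebra

namespace TreeDecomp

open Finsupp Module Submodule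
open scoped Graph

variable {α β ι : Type*} {k l l' : ℕ} {G H : Graph α β} {F : ι → Graph α β}
  {C : Set α} {e : β} {x y : α}

lemma Reachable.symm (h : Reachable G x y) : Reachable G y x :=
  Relation.ReflTransGen.stdSymm.symm _ _ h

lemma Reachable.mono (hle : H ≤ G) (h : Reachable H x y) : Reachable G x y :=
  Relation.ReflTransGen.mono (fun _ _ hadj ↦ hadj.mono hle) _ _ h

lemma Reachable.of_isLink (h : G.IsLink e x y) : Reachable G x y := .single ⟨e, h⟩

lemma Reachable.mem_vertexSet (h : Reachable G x y) (hx : x ∈ V(G)) : y ∈ V(G) := by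
  induction h with
  | refl => exact hx
  | tail _ hadj _ => exact hadj.right_mem

/-- The set of vertices reachable from `x`. If `x` is not a vertex of `G`, this is the junk
value `{x}`, which is not a component of `G`. -/
def componentOf (G : Graph α β) (x : α) : Set α := {y | Reachable G x y}

lemma mem_componentOf_self (G : Graph α β) (x : α) : x ∈ componentOf G x := .refl

lemma componentOf_eq_componentOf_iff : componentOf G x = componentOf G y ↔ Reachable G x y where
  mp h := (h ▸ mem_componentOf_self G y : y ∈ componentOf G x)
  mpr h := Set.ext fun _ ↦ ⟨h.symm.trans, h.trans⟩

lemma components_eq_image (G : Graph α β) : components G = componentOf G '' V(G) := by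
  ext C
  simp only [components, componentOf, Set.mem_ofPred_eq, Set.mem_image, eq_comm]

lemma componentOf_mem_components (hx : x ∈ V(G)) : componentOf G x ∈ components G := ⟨x, hx, rfl⟩

lemma componentOf_eq_of_mem (hC : C ∈ components G) (hx : x ∈ C) : componentOf G x = C := by
  obtain ⟨y, -, rfl⟩ := hC
  exact (componentOf_eq_componentOf_iff.2 hx).symm

lemma subset_vertexSet_of_mem_components (hC : C ∈ components G) : C ⊆ V(G) := by
  obtain ⟨y, hy, rfl⟩ := hC
  exact fun x hx ↦ Reachable.mem_vertexSet hx hy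

lemma nonempty_of_mem_components (hC : C ∈ components G) : C.Nonempty := by
  obtain ⟨y, -, rfl⟩ := hC
  exact ⟨y, .refl⟩

lemma finite_components (hV : V(G).Finite) : (components G).Finite := by
  rw [components_eq_image]
  exact hV.image _

lemma components_pairwiseDisjoint (G : Graph α β) : (components G).PairwiseDisjoint id :=
  fun _ hC _ hD hne ↦ Set.disjoint_left.2 fun _ hxC hxD ↦
    hne ((componentOf_eq_of_mem hC hxC).symm.trans (componentOf_eq_of_mem hD hxD))

lemma biUnion_components (G : Graph α β) : ⋃ C ∈ components G, C = V(G) :=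
  (Set.iUnion₂_subset fun _ ↦ subset_vertexSet_of_mem_components).antisymm fun x hx ↦
    Set.mem_biUnion (componentOf_mem_components hx) (mem_componentOf_self G x)

lemma biUnion_edgeSet_induce_components (G : Graph α β) :
    ⋃ C ∈ components G, E(G.induce C) = E(G) := by
  refine (Set.iUnion₂_subset fun C hC ↦
    (Graph.induce_le (subset_vertexSet_of_mem_components hC)).edgeSet_mono).antisymm fun e he ↦ ?_
  obtain ⟨x, y, hxy⟩ := G.exists_isLink_of_mem_edgeSet he
  exact Set.mem_biUnion (componentOf_mem_components hxy.left_mem)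
    ⟨x, y, hxy, mem_componentOf_self G x, .of_isLink hxy⟩

lemma sum_ncard_components (hV : V(G).Finite) :
    ∑ C ∈ (finite_components hV).toFinset, C.ncard = V(G).ncard := by
  rw [← finsum_mem_eq_finite_toFinset_sum, ← (finite_components hV).ncard_biUnion
    (fun C hC ↦ hV.subset (subset_vertexSet_of_mem_components hC)) (components_pairwiseDisjoint G),
    biUnion_components]

lemma ncard_edgeSet_le_sum_induce_components (hV : V(G).Finite) :
    E(G).ncard ≤ ∑ C ∈ (finite_components hV).toFinset, E(G.induce C).ncard := by
  rw [← finsum_mem_eq_finite_toFinset_sum]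
  conv_lhs => rw [← biUnion_edgeSet_induce_components]
  exact (finite_components hV).ncard_biUnion_le _

open Classical in
/-- The column of the edge `e` in the incidence matrix of `G` over the field with two elements,
where orientations do not matter: the sum of the two ends of `e`. It vanishes if `e` is a loop, and
by convention if `e` is not an edge. -/
noncomputable def incidenceVector (G : Graph α β) (e : β) : α →₀ ZMod 2 :=
  if h : ∃ x y, G.IsLink e x y then single h.choose 1 + single h.choose_spec.choose 1 else 0

lemma incidenceVector_of_isLink (h : G.IsLink e x y) :
    incidenceVector G e = single x 1 + single y 1 := by
  have hex : ∃ x y, G.IsLink e x y := ⟨x, y, h⟩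
  rw [incidenceVector, dif_pos hex]
  obtain ⟨h₁, h₂⟩ | ⟨h₁, h₂⟩ := hex.choose_spec.choose_spec.eq_and_eq_or_eq_and_eq h
  · exact congrArg₂ (fun a b ↦ single a 1 + single b 1) h₁ h₂
  · exact (congrArg₂ (fun a b ↦ single a 1 + single b 1) h₁ h₂).trans (add_comm _ _)

/-- The linear map that adds up the coordinates of a vector over each component of `G`. -/
noncomputable def componentSum (G : Graph α β) : (α →₀ ZMod 2) →ₗ[ZMod 2] (Set α →₀ ZMod 2) :=
  lmapDomain (ZMod 2) (ZMod 2) (componentOf G)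

lemma componentSum_single (G : Graph α β) (x : α) :
    componentSum G (single x 1) = single (componentOf G x) 1 :=
  (lmapDomain_apply ..).trans mapDomain_single

lemma single_add_single_mem_ker_componentSum_iff :
    single x 1 + single y 1 ∈ LinearMap.ker (componentSum G) ↔ Reachable G x y := by
  rw [LinearMap.mem_ker, map_add, componentSum_single, componentSum_single,
    ← ZModModule.sub_eq_add, sub_eq_zero, single_left_inj one_ne_zero,
    componentOf_eq_componentOf_iff]

lemma Reachable.single_add_single_mem_span (hle : H ≤ G) (h : Reachable H x y) :
    single x 1 + single y 1 ∈ span (ZMod 2) (incidenceVector G '' E(H)) := by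
  induction h with
  | refl => rw [ZModModule.add_self]; exact zero_mem _
  | @tail y z _ hadj ih =>
    obtain ⟨e, he⟩ := hadj
    have h_edge := subset_span (R := ZMod 2) (Set.mem_image_of_mem (incidenceVector G) he.edge_mem)
    rw [incidenceVector_of_isLink (he.mono hle)] at h_edge
    rw [← ZModModule.add_add_add_cancel (single x 1) (single y 1) (single z 1)]
    exact add_mem ih h_edge

lemma span_incidenceVector_image_edgeSet (hle : H ≤ G) :
    span (ZMod 2) (incidenceVector G '' E(H)) = LinearMap.ker (componentSum H) := by
  set W := span (ZMod 2) (incidenceVector G '' E(H)) with hW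
  apply le_antisymm
  · rw [hW, span_le]
    rintro _ ⟨e, he, rfl⟩
    obtain ⟨x, y, hxy⟩ := H.exists_isLink_of_mem_edgeSet he
    rw [incidenceVector_of_isLink (hxy.mono hle)]
    exact single_add_single_mem_ker_componentSum_iff.2 (.of_isLink hxy)
  -- Modulo `W` the vector `single x 1` only depends on the component of `x`, so the quotient map
  -- factors through `componentSum H`.
  let q (x : α) : (α →₀ ZMod 2) ⧸ W := W.mkQ (single x 1)
  have q_factors : q.FactorsThrough (componentOf H) := fun x y hxy ↦ by
    rw [componentOf_eq_componentOf_iff] at hxy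
    rw [← sub_eq_zero, ← map_sub, ZModModule.sub_eq_add]
    exact (Submodule.Quotient.mk_eq_zero W).2 (hxy.single_add_single_mem_span hle)
  have mkQ_eq : W.mkQ = linearCombination (ZMod 2) (Function.extend (componentOf H) q 0) ∘ₗ
      componentSum H := by
    ext x : 2
    simpa [q, componentSum_single] using (q_factors.extend_apply 0 x).symm
  rw [← W.ker_mkQ, mkQ_eq]
  exact LinearMap.ker_le_ker_comp _ _

lemma map_componentSum_supported (G : Graph α β) :
    (supported (ZMod 2) (ZMod 2) V(G)).map (componentSum G) =
      supported (ZMod 2) (ZMod 2) (components G) := by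
  rw [components_eq_image]
  exact lmapDomain_supported ..

theorem finrank_span_incidenceVector_add_ncard_components (hle : H ≤ G) (hV : V(H).Finite) :
    finrank (ZMod 2) (span (ZMod 2) (incidenceVector G '' E(H))) + (components H).ncard =
      V(H).ncard := by
  have h_le : span (ZMod 2) (incidenceVector G '' E(H)) ≤ supported (ZMod 2) (ZMod 2) V(H) := by
    rw [span_le]
    rintro _ ⟨e, he, rfl⟩
    obtain ⟨x, y, hxy⟩ := H.exists_isLink_of_mem_edgeSet he
    rw [incidenceVector_of_isLink (hxy.mono hle)]
    exact add_mem (single_mem_supported _ _ hxy.left_mem) (single_mem_supported _ _ hxy.right_mem)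
  have := hV.to_subtype
  have : FiniteDimensional (ZMod 2) (supported (ZMod 2) (ZMod 2) V(H)) :=
    .of_injective (supportedEquivFinsupp V(H)).toLinearMap (LinearEquiv.injective _)
  have h := finrank_map_add_finrank_inf_ker (componentSum H) (supported (ZMod 2) (ZMod 2) V(H))
  rwa [map_componentSum_supported, finrank_supported, finrank_supported,
    ← span_incidenceVector_image_edgeSet hle, inf_eq_right.2 h_le, add_comm] at h

lemma IsAcyclic.mono (hG : IsAcyclic G) (hle : H ≤ G) : IsAcyclic H := fun e x y hxy hr ↦
  hG e x y (hxy.mono hle) (hr.mono (Graph.deleteEdges_mono_left hle {e}))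

lemma isAcyclic_iff_linearIndepOn_incidenceVector (hle : H ≤ G) :
    IsAcyclic H ↔ LinearIndepOn (ZMod 2) (incidenceVector G) E(H) := by
  have mem_span_iff {e : β} {x y : α} (hxy : H.IsLink e x y) :
      incidenceVector G e ∈ span (ZMod 2) (incidenceVector G '' (E(H) \ {e})) ↔
        Reachable (H.deleteEdges {e}) x y := by
    rw [← Graph.edgeSet_deleteEdges,
      span_incidenceVector_image_edgeSet (Graph.deleteEdges_le.trans hle),
      incidenceVector_of_isLink (hxy.mono hle), single_add_single_mem_ker_componentSum_iff]
  rw [linearIndepOn_iff_notMem_span]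
  refine ⟨fun hH e he ↦ ?_, fun h e x y hxy ↦ mt (mem_span_iff hxy).2 (h e hxy.edge_mem)⟩
  obtain ⟨x, y, hxy⟩ := H.exists_isLink_of_mem_edgeSet he
  exact mt (mem_span_iff hxy).1 (hH e x y hxy)

theorem IsAcyclic.ncard_edgeSet_add_ncard_components (hG : IsAcyclic G) (hV : V(G).Finite) :
    E(G).ncard + (components G).ncard = V(G).ncard := by
  rw [← finrank_span_image_eq_ncard ((isAcyclic_iff_linearIndepOn_incidenceVector le_rfl).1 hG),
    finrank_span_incidenceVector_add_ncard_components le_rfl hV]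

lemma finite_edgeSet_of_forall_ncard_le {n : ℕ}
    (h : ∀ H ≤ G, V(H) = V(G) → E(H).ncard ≤ n) : E(G).Finite := by
  by_contra hE
  obtain ⟨E', hE'G, -, hE'n⟩ := Set.Infinite.exists_subset_ncard_eq hE (n + 1)
  have := h (G.restrict E') Graph.restrict_le rfl
  rw [Graph.edgeSet_restrict, Set.inter_eq_right.2 hE'G] at this
  lia

lemma IsAcyclic.finite_edgeSet (hG : IsAcyclic G) (hV : V(G).Finite) : E(G).Finite :=
  finite_edgeSet_of_forall_ncard_le (n := V(G).ncard) fun H hle hVH ↦ by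
    have := (hG.mono hle).ncard_edgeSet_add_ncard_components (hVH ▸ hV)
    lia

lemma IsSparse.mono (hG : IsSparse k l G) (hle : H ≤ G) : IsSparse k l H :=
  fun K hK ↦ hG K (hK.trans hle)

lemma IsSparse.anti (hll' : l' ≤ l) (hG : IsSparse k l G) : IsSparse k l' G :=
  fun H hle hE ↦ (hG H hle hE).trans (by gcongr)

lemma IsSparse.finite_edgeSet (hG : IsSparse k l G) : E(G).Finite :=
  finite_edgeSet_of_forall_ncard_le (n := k * V(G).ncard) fun H hle hVH ↦ by
    obtain hE | hE := E(H).eq_empty_or_nonempty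
    · simp [hE]
    · have := hG H hle hE
      rw [hVH] at this
      lia

lemma IsSparse.ncard_edgeSet_add_le (hG : IsSparse k k G) (hV : V(G).Finite)
    (hne : V(G).Nonempty) : E(G).ncard + k ≤ k * V(G).ncard := by
  obtain hE | hE := E(G).eq_empty_or_nonempty
  · rw [hE, Set.ncard_empty, zero_add]
    exact Nat.le_mul_of_pos_right k (hne.ncard_pos hV)
  · have := hG G le_rfl hE
    lia

lemma IsSparse.ncard_edgeSet_add_mul_ncard_components_le (hG : IsSparse k k G)
    (hV : V(G).Finite) : E(G).ncard + k * (components G).ncard ≤ k * V(G).ncard := by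
  set 𝒞 := (finite_components hV).toFinset
  calc E(G).ncard + k * (components G).ncard
    _ ≤ ∑ C ∈ 𝒞, E(G.induce C).ncard + k * (components G).ncard := by
        gcongr
        exact ncard_edgeSet_le_sum_induce_components hV
    _ = ∑ C ∈ 𝒞, (E(G.induce C).ncard + k) := by
        rw [Finset.sum_add_distrib, Finset.sum_const, smul_eq_mul, mul_comm k,
          Set.ncard_eq_toFinset_card _ (finite_components hV)]
    _ ≤ ∑ C ∈ 𝒞, k * C.ncard := Finset.sum_le_sum fun C hC ↦ by
        rw [Set.Finite.mem_toFinset] at hC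
        have hCV := subset_vertexSet_of_mem_components hC
        exact (hG.mono (Graph.induce_le hCV)).ncard_edgeSet_add_le (hV.subset hCV)
          (nonempty_of_mem_components hC)
    _ = k * V(G).ncard := by rw [← Finset.mul_sum, sum_ncard_components hV]

lemma IsSparse.ncard_le_mul_finrank_span_incidenceVector (hG : IsSparse k k G)
    (hV : V(G).Finite) {J : Set β} (hJ : J ⊆ E(G)) :
    J.ncard ≤ k * finrank (ZMod 2) (span (ZMod 2) (incidenceVector G '' J)) := by
  have hE : E(G.restrict J) = J := by rw [Graph.edgeSet_restrict, Set.inter_eq_right.2 hJ]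
  have h_rank := finrank_span_incidenceVector_add_ncard_components (H := G.restrict J)
    Graph.restrict_le hV
  have h_sparse := (hG.mono Graph.restrict_le).ncard_edgeSet_add_mul_ncard_components_le
    (G := G.restrict J) hV
  rw [hE] at h_rank h_sparse
  rw [← h_rank, mul_add] at h_sparse
  lia

/-- `F` partitions the edges of `G` into forests such that each vertex lies in exactly `k` of them.
This contains both the partitions into `k` spanning forests and, with the trees as forests, the
`ℓTk` decompositions. -/
structure IsForestDecomposition (k : ℕ) (G : Graph α β) (F : ι → Graph α β) :
    Prop where
  le : ∀ i, F i ≤ G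
  isAcyclic : ∀ i, IsAcyclic (F i)
  edge_disjoint : ∀ i j, i ≠ j → Disjoint E(F i) E(F j)
  edge_cover : ∀ e ∈ E(G), ∃ i, e ∈ E(F i)
  vertex_count : ∀ v ∈ V(G), {i | v ∈ V(F i)}.ncard = k

/-- **Nash-Williams' arboricity theorem**, as the Rado-Horn theorem for incidence vectors. -/
theorem IsSparse.exists_isForestDecomposition (hG : IsSparse k k G) (hV : V(G).Finite) :
    ∃ F : Fin k → Graph α β, IsForestDecomposition k G F := by
  have := hG.finite_edgeSet.to_subtype
  obtain ⟨c, hc⟩ := exists_coloring_linearIndepOn (K := ZMod 2) (k := k)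
    (v := fun e : E(G) ↦ incidenceVector G e) fun J ↦ by
      have := hG.ncard_le_mul_finrank_span_incidenceVector hV (Subtype.coe_image_subset E(G) J)
      rwa [Set.ncard_image_of_injective _ Subtype.val_injective, Set.ncard_coe_finset,
        Set.image_image] at this
  have edgeSet_restrict (i : Fin k) : E(G.restrict ((↑) '' (c ⁻¹' {i}))) = (↑) '' (c ⁻¹' {i}) := by
    rw [Graph.edgeSet_restrict, Set.inter_eq_right.2 (Subtype.coe_image_subset ..)]
  refine ⟨fun i ↦ G.restrict ((↑) '' (c ⁻¹' {i})), fun i ↦ Graph.restrict_le, fun i ↦ ?_,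
    fun i j hij ↦ ?_, fun e he ↦ ⟨c ⟨e, he⟩, ?_⟩, fun v hv ↦ ?_⟩
  · rw [isAcyclic_iff_linearIndepOn_incidenceVector Graph.restrict_le, edgeSet_restrict]
    exact .image_of_comp _ _ (hc i)
  · rw [edgeSet_restrict, edgeSet_restrict, Set.disjoint_image_iff Subtype.val_injective]
    exact Disjoint.preimage _ (by simpa)
  · rw [edgeSet_restrict]
    exact ⟨⟨e, he⟩, rfl, rfl⟩
  · simp [hv, Set.ncard_univ]

namespace IsForestDecomposition

lemma finite_edgeSet [Finite ι] (hF : IsForestDecomposition k G F) (hV : V(G).Finite) :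
    E(G).Finite :=
  (Set.finite_iUnion fun i ↦ (hF.isAcyclic i).finite_edgeSet
    (hV.subset (hF.le i).vertexSet_mono)).subset fun e he ↦ Set.mem_iUnion.2 (hF.edge_cover e he)

/-- Sum `m - n + c = 0` over the forests `F i ⊓ H`. -/
theorem sum_ncard_components_inf_add_ncard_edgeSet [Fintype ι] (hF : IsForestDecomposition k G F)
    (hV : V(G).Finite) (hle : H ≤ G) :
    ∑ i, (components (F i ⊓ H)).ncard + E(H).ncard = k * V(H).ncard := by
  have hVH : V(H).Finite := hV.subset hle.vertexSet_mono
  have hEH : E(H).Finite := (hF.finite_edgeSet hV).subset hle.edgeSet_mono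
  have forest_formula (i : ι) :
      (E(F i) ∩ E(H)).ncard + (components (F i ⊓ H)).ncard = (V(F i) ∩ V(H)).ncard := by
    rw [← (Graph.Compatible.of_le_le (hF.le i) hle).edgeSet_inf, ← Graph.vertexSet_inf]
    exact ((hF.isAcyclic i).mono inf_le_left).ncard_edgeSet_add_ncard_components
      (hVH.subset Set.inter_subset_right)
  rw [← sum_ncard_inter_eq_mul hVH fun v hv ↦ hF.vertex_count v (hle.vertexSet_mono hv),
    ← sum_ncard_inter_eq_ncard hEH hF.edge_disjoint
      fun e he ↦ hF.edge_cover e (hle.edgeSet_mono he),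
    add_comm, ← Finset.sum_add_distrib]
  exact Finset.sum_congr rfl fun i _ ↦ forest_formula i

lemma comp_equiv {ι' : Type*} (hF : IsForestDecomposition k G F) (f : ι' ≃ ι) :
    IsForestDecomposition k G (F ∘ f) where
  le i := hF.le (f i)
  isAcyclic i := hF.isAcyclic (f i)
  edge_disjoint i j hij := hF.edge_disjoint _ _ (f.injective.ne hij)
  edge_cover e he := (f.surjective.exists (p := (e ∈ E(F ·)))).1 (hF.edge_cover e he)
  vertex_count v hv :=
    (Set.ncard_preimage_of_injective_subset_range (s := {i | v ∈ V(F i)}) f.injective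
      (by simp)).trans (hF.vertex_count v hv)

end IsForestDecomposition

/-- The trees that make up a family `F` of forests, indexed by the pairs of a forest and one of its
components. -/
def treesOfForests (F : ι → Graph α β) (p : Σ i, components (F i)) : Graph α β :=
  (F p.1).induce p.2

lemma treesOfForests_le (F : ι → Graph α β) (p : Σ i, components (F i)) :
    treesOfForests F p ≤ F p.1 :=
  Graph.induce_le (subset_vertexSet_of_mem_components p.2.2)

lemma Reachable.induce (hC : C ∈ components G) (hx : x ∈ C) (h : Reachable G x y) :
    Reachable (G.induce C) x y := by
  induction h with
  | refl => exact .refl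
  | @tail y z hxy hadj ih =>
    obtain ⟨e, he⟩ := hadj
    rw [← componentOf_eq_of_mem hC hx] at ih ⊢
    exact ih.tail ⟨e, he, hxy, hxy.tail ⟨e, he⟩⟩

lemma IsAcyclic.isTree_induce (hG : IsAcyclic G) (hC : C ∈ components G) :
    IsTree (G.induce C) :=
  ⟨⟨nonempty_of_mem_components hC, fun x hx y hy ↦ Reachable.induce hC hx <| by
      rw [← componentOf_eq_componentOf_iff, componentOf_eq_of_mem hC hx,
        componentOf_eq_of_mem hC hy]⟩,
    hG.mono (Graph.induce_le (subset_vertexSet_of_mem_components hC))⟩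

lemma disjoint_edgeSet_induce {C D : Set α} (h : Disjoint C D) :
    Disjoint E(G.induce C) E(G.induce D) := by
  rw [Set.disjoint_left] at h ⊢
  rintro e ⟨x, y, hxy, hx, -⟩ ⟨x', y', hxy', hx', hy'⟩
  obtain ⟨rfl, -⟩ | ⟨rfl, -⟩ := hxy.eq_and_eq_or_eq_and_eq hxy'
  exacts [h hx hx', h hx hy']

lemma IsForestDecomposition.isTree_treesOfForests (hF : IsForestDecomposition k G F)
    (p : Σ i, components (F i)) : IsTree (treesOfForests F p) :=
  (hF.isAcyclic p.1).isTree_induce p.2.2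

lemma IsForestDecomposition.treesOfForests (hF : IsForestDecomposition k G F) :
    IsForestDecomposition k G (treesOfForests F) where
  le p := (treesOfForests_le F p).trans (hF.le p.1)
  isAcyclic p := (hF.isTree_treesOfForests p).2
  edge_disjoint := by
    rintro ⟨i, C⟩ ⟨j, D⟩ hne
    obtain rfl | hij := eq_or_ne i j
    · exact disjoint_edgeSet_induce (components_pairwiseDisjoint (F i) C.2 D.2
        fun h ↦ hne (by rw [Subtype.ext h]))
    · exact (hF.edge_disjoint i j hij).mono (treesOfForests_le F ⟨i, C⟩).edgeSet_mono
        (treesOfForests_le F ⟨j, D⟩).edgeSet_mono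
  edge_cover e he := by
    obtain ⟨i, hi⟩ := hF.edge_cover e he
    rw [← biUnion_edgeSet_induce_components] at hi
    obtain ⟨C, hC, heC⟩ := Set.mem_iUnion₂.1 hi
    exact ⟨⟨i, C, hC⟩, heC⟩
  vertex_count v hv := by
    have h_inj : Set.InjOn Sigma.fst {p : Σ i, components (F i) | v ∈ p.2.1} := by
      rintro ⟨i, C, hC⟩ (hvC : v ∈ C) ⟨_, D, hD⟩ (hvD : v ∈ D) rfl
      obtain rfl : C = D :=
        (componentOf_eq_of_mem hC hvC).symm.trans (componentOf_eq_of_mem hD hvD)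
      rfl
    have h_image : Sigma.fst '' {p : Σ i, components (F i) | v ∈ p.2.1} = {i | v ∈ V(F i)} := by
      ext i
      refine ⟨?_, fun hi ↦ ⟨⟨i, _, componentOf_mem_components hi⟩, mem_componentOf_self _ v, rfl⟩⟩
      rintro ⟨⟨i, C, hC⟩, hvC, rfl⟩
      exact subset_vertexSet_of_mem_components hC hvC
    rw [← hF.vertex_count v hv, ← h_image, h_inj.ncard_image]
    rfl

theorem IsForestDecomposition.exists_isTreeDecomposition [Finite ι]
    (hF : IsForestDecomposition k G F) (hV : V(G).Finite) (hl : E(G).ncard + l = k * V(G).ncard) :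
    ∃ T : Fin l → Graph α β, IsTreeDecomposition k l G T := by
  have := Fintype.ofFinite ι
  have (i : ι) : Finite (components (F i)) :=
    finite_components (hV.subset (hF.le i).vertexSet_mono)
  have card_trees : Nat.card (Σ i, components (F i)) = l := by
    have h := hF.sum_ncard_components_inf_add_ncard_edgeSet hV le_rfl
    simp only [inf_eq_left.2 (hF.le _)] at h
    simp only [Nat.card_sigma, Nat.card_coe_set_eq]
    lia
  let f : Fin l ≃ Σ i, components (F i) := (Finite.equivFinOfCardEq card_trees).symm
  obtain ⟨le, -, edge_disjoint, edge_cover, vertex_count⟩ := hF.treesOfForests.comp_equiv f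
  exact ⟨_, le, fun j ↦ hF.isTree_treesOfForests (f j), edge_disjoint, edge_cover, vertex_count⟩

lemma IsConnected.ncard_components (hG : IsConnected G) : (components G).ncard = 1 := by
  obtain ⟨⟨x, hx⟩, h⟩ := hG
  rw [Set.ncard_eq_one]
  refine ⟨componentOf G x,
    Set.eq_singleton_iff_unique_mem.2 ⟨componentOf_mem_components hx, ?_⟩⟩
  rintro _ ⟨y, hy, rfl⟩
  exact componentOf_eq_componentOf_iff.2 (h y hy x hx)

namespace IsTreeDecomposition

variable {T : Fin l → Graph α β}

lemma isForestDecomposition (hT : IsTreeDecomposition k l G T) : IsForestDecomposition k G T :=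
  ⟨hT.le, fun i ↦ (hT.isTree i).2, hT.edge_disjoint, hT.edge_cover, hT.vertex_count⟩

theorem numTreePieces_add_ncard_edgeSet (hT : IsTreeDecomposition k l G T) (hV : V(G).Finite)
    (hle : H ≤ G) : numTreePieces T H + E(H).ncard = k * V(H).ncard :=
  hT.isForestDecomposition.sum_ncard_components_inf_add_ncard_edgeSet hV hle

lemma numTreePieces_self (hT : IsTreeDecomposition k l G T) : numTreePieces T G = l := by
  simp [numTreePieces, inf_eq_left.2 (hT.le _), (hT.isTree _).1.ncard_components]

lemma nontrivial_of_edgeSet_nonempty (hT : IsTreeDecomposition k l G T) (hle : H ≤ G)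
    (hne : E(H).Nonempty) : V(H).Nontrivial := by
  obtain ⟨e, he⟩ := hne
  obtain ⟨x, y, hxy⟩ := H.exists_isLink_of_mem_edgeSet he
  refine ⟨x, hxy.left_mem, y, hxy.right_mem, ?_⟩
  rintro rfl
  obtain ⟨i, hi⟩ := hT.edge_cover e (hle.edgeSet_mono he)
  exact (hT.isTree i).2 e x x (((hT.le i).isLink_iff hi).2 (hxy.mono hle)) .refl

lemma isSparse_of_isProper (hT : IsTreeDecomposition k l G T) (hV : V(G).Finite)
    (h_proper : IsProper G T) : IsSparse k l G := fun H hle hne ↦ by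
  have h_count := hT.numTreePieces_add_ncard_edgeSet hV hle
  have h_pieces := h_proper H hle (hT.nontrivial_of_edgeSet_nonempty hle hne)
  lia

lemma isProper_of_isSparse (hT : IsTreeDecomposition k l G T) (hV : V(G).Finite)
    (hlk : l ≤ 2 * k) (h_sparse : IsSparse k l G) : IsProper G T := fun H hle h_nontrivial ↦ by
  have h_count := hT.numTreePieces_add_ncard_edgeSet hV hle
  obtain hE | hE := E(H).eq_empty_or_nonempty
  · have := (hV.subset hle.vertexSet_mono).to_subtype
    have h_two_le : 2 ≤ V(H).ncard := Set.one_lt_ncard_iff_nontrivial.2 h_nontrivial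
    rw [hE, Set.ncard_empty, add_zero] at h_count
    rw [h_count, mul_comm]
    exact hlk.trans (Nat.mul_le_mul_right k h_two_le)
  · have := h_sparse H hle hE
    lia

end IsTreeDecomposition

theorem IsTight.isProperLTk (hG : IsTight k l G) (hkl : k ≤ l) (hlk : l ≤ 2 * k)
    (hV : V(G).Finite) : IsProperLTk k l G := by
  obtain ⟨h_sparse, h_card⟩ := hG
  obtain ⟨F, hF⟩ := (h_sparse.anti hkl).exists_isForestDecomposition hV
  obtain ⟨T, hT⟩ := hF.exists_isTreeDecomposition (l := l) hV (by lia)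
  exact ⟨T, hT, hT.isProper_of_isSparse hV hlk h_sparse⟩

theorem IsProperLTk.isTight (hG : IsProperLTk k l G) (hV : V(G).Finite) : IsTight k l G := by
  obtain ⟨T, hT, h_proper⟩ := hG
  have h_count := hT.numTreePieces_add_ncard_edgeSet hV le_rfl
  rw [hT.numTreePieces_self] at h_count
  exact ⟨hT.isSparse_of_isProper hV h_proper, by lia⟩

end TreeDecomp

theorem mainTheorem6_general {α β : Type*} (k l : ℕ) (hkl : k ≤ l) (hlk : l ≤ 2 * k)
    (G : Graph α β) (hV : G.vertexSet.Finite) :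
    TreeDecomp.IsTight k l G ↔ TreeDecomp.IsProperLTk k l G :=
  ⟨fun hG ↦ hG.isProperLTk hkl hlk hV, fun hG ↦ hG.isTight hV⟩

theorem mainTheorem6 {α β : Type*} (k l : ℕ) (hkl : k ≤ l) (hlk : (l : ℤ) ≤ 2 * (k : ℤ) - 1)
    (G : Graph α β) (hV : G.vertexSet.Finite) (hE : G.edgeSet.Finite) :
    TreeDecomp.IsTight k l G ↔ TreeDecomp.IsProperLTk k l G :=
  mainTheorem6_general k l hkl (by lia) G hV
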